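/- Let $F$ be a non-Archimedean local field of arbitrary characteristic, with absolute value $|\cdot|_F$ and ring of integers $\mathcal O_F$. Let $X$ be a smooth $F$-variety (a smooth, separated scheme of finite type over $F$), and regard $X(F)$ as an $F$-analytic manifold. A positive Borel measure $\mu$ on $X(F)$ is called smooth if for every $F$-analytic chart $\psi:V\to F^n$ defined on an open $V\subseteq X(F)$, the push-forward $\psi_*(\mu|_V)$ has on $\psi(V)$ a locally constant density with respect to the Haar measure on $F^n$ normalized by giving $\mathcal O_F^n$ volume $1$. For an open set $U\subseteq X(F)$ let $\mathcal M_c^\infty(U)$ be the set of smooth measures with compact support contained in $U$. For $F$-analytic functions $f_1,\dots,f_r:X(F)\to F$ generating an ideal $J$ and for $x_0\in X(F)$ put \[ \operatorname{lct}_F(J;x_0):=\sup\Big\{s\ge 0:\ \exists\, U\ni x_0 \text{ open such that } \forall \mu\in\mathcal M_c^\infty(U),\ \int \min_{1\le i\le r}|f_i(x)|_F^{-s}\,d\mu(x)<\infty\Big\}\in[0,\infty]. \] Let $\varphi_1,\dots,\varphi_r$ be regular functions on $X$ such that on every irreducible component of $X$ at least one $\varphi_i$ is not identically zero. Let $\varphi_{i,F}:X(F)\to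 F$ be the analytic function induced by $\varphi_i$, and let $J=\langle\varphi_{1,F},\dots,\varphi_{r,F}\rangle$. Then there exists $\epsilon>0$ such that for every $x_0\in X(F)$, \[ \operatorname{lct}_F(J;x_0)>\epsilon . \] -/

import Mathlib

open AlgebraicGeometry CategoryTheory MeasureTheory Topology
open scoped NNReal ENNReal

universe u v

noncomputable section

namespace AnalyticLct

/-! ### Smooth measures and the analytic log-canonical threshold

`F` is a non-Archimedean local field. An `F`-analytic manifold is given by a topological space `M`
with its maximal atlas `A`: for every `n`, the set `A n` of the analytic charts with values
in `F ^ n`. -/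

section Manifold

variable {F : Type u} [NontriviallyNormedField F] [LocallyCompactSpace F]
  [MeasurableSpace F] [BorelSpace F]
variable {M : Type v} [TopologicalSpace M]

/-- The compact neighbourhood `O_F ^ n` of `0` in `F ^ n` (which carries the sup norm). -/
def integerBox (F : Type u) [NontriviallyNormedField F] [LocallyCompactSpace F] (n : ℕ) :
    TopologicalSpace.PositiveCompacts (Fin n → F) where
  carrier := Metric.closedBall 0 1
  isCompact' := by
    have : ProperSpace F := ProperSpace.of_locallyCompactSpace F
    exact isCompact_closedBall _ _
  interior_nonempty' :=
    ⟨0, interior_mono Metric.ball_subset_closedBall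
      (by rw [Metric.isOpen_ball.interior_eq]; exact Metric.mem_ball_self one_pos)⟩

/-- The Haar measure on `F ^ n` for which `O_F ^ n` has volume `1`. -/
def haar (F : Type u) [NontriviallyNormedField F] [LocallyCompactSpace F]
    [MeasurableSpace F] [BorelSpace F] (n : ℕ) : Measure (Fin n → F) :=
  haveI : ProperSpace F := ProperSpace.of_locallyCompactSpace F
  Measure.addHaarMeasure (integerBox F n)

variable [MeasurableSpace M]

/-- A smooth measure: in every chart its push-forward has a locally constant (finite) density with
respect to the Haar measure. -/
def IsSmoothMeasure (A : ∀ n : ℕ, Set (OpenPartialHomeomorph M (Fin n → F)))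
    (μ : Measure M) : Prop :=
  ∀ n : ℕ, ∀ ψ ∈ A n, ∃ ρ : (Fin n → F) → ℝ≥0,
    (∀ y ∈ ψ.target, ∀ᶠ z in 𝓝 y, ρ z = ρ y) ∧
    (μ.restrict ψ.source).map ψ =
      ((haar F n).restrict ψ.target).withDensity fun y => (ρ y : ℝ≥0∞)

/-- `μ` has compact support contained in `U`. -/
def CompactlySupportedIn (μ : Measure M) (U : Set M) : Prop :=
  ∃ K : Set M, IsCompact K ∧ K ⊆ U ∧ μ Kᶜ = 0

/-- `min_i |f_i|^{-s}` is locally integrable at `x₀`, tested on the smooth measures with compact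
support in some open neighbourhood of `x₀`. In `ℝ≥0∞` one has `0 ^ (-s) = ∞` for `s > 0`. -/
def IntegrableNear (A : ∀ n : ℕ, Set (OpenPartialHomeomorph M (Fin n → F)))
    {r : ℕ} (f : Fin r → M → F) (x₀ : M) (s : ℝ≥0) : Prop :=
  ∃ U : Set M, IsOpen U ∧ x₀ ∈ U ∧ ∀ μ : Measure M,
    IsSmoothMeasure A μ → CompactlySupportedIn μ U →
      ∫⁻ x, ⨅ i, ‖f i x‖ₑ ^ (-(s : ℝ)) ∂μ < ∞

/-- The `F`-analytic log-canonical threshold at `x₀` of the ideal generated by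
`f 0, …, f (r - 1)`, as an element of `[0, ∞]`. -/
def lct (A : ∀ n : ℕ, Set (OpenPartialHomeomorph M (Fin n → F)))
    {r : ℕ} (f : Fin r → M → F) (x₀ : M) : ℝ≥0∞ :=
  sSup {t : ℝ≥0∞ | ∃ s : ℝ≥0, IntegrableNear A f x₀ s ∧ t = (s : ℝ≥0∞)}

end Manifold

/-! ### The `F`-analytic manifold `X(F)` -/

section Points

variable {F : Type u} [Field F] {X : Scheme.{u}}

/-- `X(F)`: the sections of the structure morphism `π : X ⟶ Spec F`. -/
def RatPoint (π : X ⟶ Spec (CommRingCat.of F)) : Type u :=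
  {x : Spec (CommRingCat.of F) ⟶ X // x ≫ π = 𝟙 _}

variable {π : X ⟶ Spec (CommRingCat.of F)}

/-- The rational point `x` lies in the Zariski open set `V`. -/
def RatPoint.MemOpen (x : RatPoint π) (V : X.Opens) : Prop := ⊤ ≤ x.1 ⁻¹ᵁ V

/-- The value in `F` of a regular function on `V` at a rational point of `V`. -/
def RatPoint.evalOn (x : RatPoint π) (V : X.Opens) (h : x.MemOpen V) (f : Γ(X, V)) : F :=
  (Scheme.ΓSpecIso (CommRingCat.of F)).hom.hom ((x.1.appLE V ⊤ h).hom f)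

open Classical in
/-- The function `V(F) → F` induced by a regular function on `V`, extended by `0` to `X(F)`. -/
def regVal (π : X ⟶ Spec (CommRingCat.of F)) (V : X.Opens) (f : Γ(X, V)) (x : RatPoint π) : F :=
  if h : x.MemOpen V then x.evalOn V h f else 0

end Points

section AnalyticStructure

variable {F : Type u} [NontriviallyNormedField F] {X : Scheme.{u}}

/-- The analytic topology on `X(F)`: the coarsest one for which `V(F)` is open for every Zariski
open `V`, and every regular function on `V` is continuous on `V(F)`. -/
instance RatPoint.instTopologicalSpace (π : X ⟶ Spec (CommRingCat.of F)) :
    TopologicalSpace (RatPoint π) :=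
  TopologicalSpace.generateFrom
    {S | ∃ (V : X.Opens) (f : Γ(X, V)) (W : Set F), IsOpen W ∧
      S = {x | x.MemOpen V ∧ regVal π V f x ∈ W}}

instance RatPoint.instMeasurableSpace (π : X ⟶ Spec (CommRingCat.of F)) :
    MeasurableSpace (RatPoint π) :=
  borel (RatPoint π)

instance RatPoint.instBorelSpace (π : X ⟶ Spec (CommRingCat.of F)) :
    BorelSpace (RatPoint π) :=
  ⟨rfl⟩

/-- The `F`-analytic charts of `X(F)` with values in `F ^ n`: homeomorphisms `ψ` from an open
subset of `X(F)` onto an open subset of `F ^ n` which are analytic in both directions. That is,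
regular functions on Zariski open sets are analytic in the coordinates given by `ψ`, and locally
`ψ` is an analytic function of finitely many regular functions. -/
def analyticCharts (π : X ⟶ Spec (CommRingCat.of F)) (n : ℕ) :
    Set (OpenPartialHomeomorph (RatPoint π) (Fin n → F)) :=
  {ψ | (∀ (V : X.Opens) (f : Γ(X, V)), ∀ y ∈ ψ.target, (ψ.symm y).MemOpen V →
          AnalyticAt F (fun z => regVal π V f (ψ.symm z)) y) ∧
       (∀ x ∈ ψ.source, ∃ (V : X.Opens) (N : ℕ) (g : Fin N → Γ(X, V))
          (H : (Fin N → F) → (Fin n → F)),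
          x.MemOpen V ∧ AnalyticAt F H (fun j => regVal π V (g j) x) ∧
          ∀ᶠ x' in 𝓝 x, ψ x' = H (fun j => regVal π V (g j) x'))}

end AnalyticStructure

end AnalyticLct

end

/-! Locally `X` is étale over affine space: around each point there is an affine open `V` with étale
coordinates `τ : F[t₁, …, tₙ] → Γ(V)`. The restricted `φ i` generate an ideal of `Γ(V)` contained in
no minimal prime (`exists_notMem_minimalPrime`). Since `Γ(V)` is quasi-finite over the domain
`F[t]`, this ideal contains `τ a = ∑ c i * φ i` for some polynomial `a ≠ 0`
(`exists_ne_zero_algebraMap_mem`). On a compact subset of `V(F)` the `c i` are bounded, so the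
ultrametric inequality gives `min |φ i|^{-s} ≤ C^s |a|^{-s}`. The étale coordinates form an analytic
chart (`exists_analyticChart_of_etale`), in which a smooth measure has bounded density on compact
sets. It remains to integrate `|a|^{-s}` over compact subsets of `F ^ n`. The admissible exponent
depends on `a` only, hence on `V` only, and finitely many `V` cover `X`. Resolution of singularities
is not used, and the characteristic plays no role.

For a one-variable polynomial `P` of degree `d ≥ 1` with leading coefficient `c`, Lagrange
interpolation covers `{|P| ≤ η^d |c|}` by at most `d` balls of radius `η`. These sublevel sets decay
fast enough that the integral of `|P|^{-s}` over a set of finite measure is at most `C |c|^{-s}`,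
with `C` independent of the coefficients (`exists_lintegral_polynomial_rpow_neg_le`). This
uniformity allows induction on `n` by Tonelli: integrating out one variable leaves a negative power
of the leading coefficient, a nonzero polynomial in the other variables. -/

noncomputable section

namespace AnalyticLct

/-! ### Sublevel sets and negative powers of one-variable polynomials. -/

section Covering

/-- If a set contains no `d + 1` points at pairwise distance larger than `η`, then it is covered
by at most `d` closed balls of radius `η`. -/
theorem exists_finset_card_le_subset_iUnion_closedBall {E : Type*} [PseudoMetricSpace E]
    (S : Set E) (η : ℝ) (hη : 0 ≤ η) (d : ℕ)
    (h : ∀ T : Finset E, (T : Set E) ⊆ S → (∀ x ∈ T, ∀ y ∈ T, x ≠ y → η < dist x y) →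
      T.card ≤ d) :
    ∃ T : Finset E, T.card ≤ d ∧ S ⊆ ⋃ x ∈ T, Metric.closedBall x η := by
  classical
  let p : ℕ → Prop := fun k => ∃ T : Finset E, (T : Set E) ⊆ S ∧
    (∀ x ∈ T, ∀ y ∈ T, x ≠ y → η < dist x y) ∧ T.card = k
  have hp0 : p 0 := ⟨∅, by simp, by simp, rfl⟩
  -- A separated subset of maximal cardinality: a point outside all its balls could be added to it.
  obtain ⟨T, hTS, hT, hc⟩ := Nat.findGreatest_spec (P := p) (Nat.zero_le d) hp0
  refine ⟨T, h T hTS hT, fun x hx => ?_⟩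
  by_contra hcon
  simp only [Set.mem_iUnion, Metric.mem_closedBall, not_exists, not_le] at hcon
  have hxT : x ∉ T := fun hxT => absurd (hcon x hxT) (by simpa using hη)
  have hsub : ((insert x T : Finset E) : Set E) ⊆ S := by
    rw [Finset.coe_insert]; exact Set.insert_subset hx hTS
  have hsep : ∀ y ∈ insert x T, ∀ z ∈ insert x T, y ≠ z → η < dist y z := by
    intro y hy z hz hyz
    rcases Finset.mem_insert.1 hy with rfl | hyT <;> rcases Finset.mem_insert.1 hz with rfl | hzT
    · exact absurd rfl hyz
    · exact hcon z hzT
    · rw [dist_comm]; exact hcon y hyT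
    · exact hT y hyT z hzT hyz
  have hcard := h _ hsub hsep
  have := Nat.le_findGreatest (P := p) hcard ⟨_, hsub, hsep, rfl⟩
  rw [Finset.card_insert_of_notMem hxT] at this
  omega

/-- Among `d + 1` points at pairwise distance larger than `η`, a polynomial of degree `d ≥ 1` with
leading coefficient `c` takes a value of norm larger than `η ^ d * ‖c‖`. -/
theorem card_le_natDegree_of_separated {F : Type*} [NontriviallyNormedField F]
    [IsUltrametricDist F]
    (P : Polynomial F) (hP : P ≠ 0) (hd : 0 < P.natDegree) {η : ℝ} (hη : 0 < η) (T : Finset F)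
    (hT : ∀ x ∈ T, ‖P.eval x‖ ≤ η ^ P.natDegree * ‖P.leadingCoeff‖)
    (hsep : ∀ x ∈ T, ∀ y ∈ T, x ≠ y → η < dist x y) : T.card ≤ P.natDegree := by
  classical
  by_contra! hcon
  obtain ⟨T', hT'T, hT'⟩ := Finset.exists_subset_card_eq (Nat.succ_le_of_lt hcon)
  have hlc : 0 < ‖P.leadingCoeff‖ := by simpa using hP
  -- The leading coefficient is `∑ P(i) / ∏_{j ≠ i} (i - j)` over `d + 1` nodes, so by the
  -- ultrametric inequality some summand is at least as large.
  have key := Lagrange.leadingCoeff_eq_sum (s := T') (v := id) (Set.injOn_id _) (P := P) (by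
    rw [hT', Polynomial.degree_eq_natDegree hP]; norm_cast)
  have hne : T'.Nonempty := Finset.card_pos.1 (by omega)
  obtain ⟨i, hi, hle⟩ := IsUltrametricDist.exists_norm_finsetSum_le_of_nonempty hne
    (fun i => P.eval (id i) / ∏ j ∈ T'.erase i, (id i - id j))
  rw [← key, norm_div, norm_prod] at hle
  simp only [id] at hle
  have hcard : (T'.erase i).card = P.natDegree := by
    rw [Finset.card_erase_of_mem hi, hT']; rfl
  have hprod : η ^ P.natDegree < ∏ j ∈ T'.erase i, ‖i - j‖ := by
    rw [← hcard, ← Finset.prod_const]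
    refine Finset.prod_lt_prod_of_nonempty (fun _ _ => hη) (fun j hj => ?_)
      (Finset.card_pos.1 (by omega))
    rw [← dist_eq_norm]
    exact hsep i (hT'T hi) j (hT'T (Finset.mem_of_mem_erase hj)) (Finset.ne_of_mem_erase hj).symm
  have hpos : 0 < ∏ j ∈ T'.erase i, ‖i - j‖ := (pow_pos hη _).trans hprod
  rw [le_div_iff₀ hpos] at hle
  have := hle.trans (hT i (hT'T hi))
  rw [mul_comm] at this
  exact absurd (le_of_mul_le_mul_right this hlc) (not_le.2 hprod)

end Covering

section OneVariable

variable {F : Type*} [NontriviallyNormedField F] [MeasurableSpace F] [BorelSpace F]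
  (μ : Measure F) [μ.IsAddHaarMeasure]

theorem measure_closedBall_eq_zero_center (x : F) (r : ℝ) :
    μ (Metric.closedBall x r) = μ (Metric.closedBall 0 r) := by
  have : Metric.closedBall x r = (fun y => -x + y) ⁻¹' Metric.closedBall 0 r := by
    ext y; simp [dist_eq_norm, sub_eq_neg_add]
  rw [this, measure_preimage_add]

variable [IsUltrametricDist F]

/-- The ball of radius `‖w‖ ^ k` contains two disjoint translates of the ball of radius `‖w‖ ^ (k +
1)`, centred at `0` and `w ^ k`; each step thus at least halves the measure. -/
theorem two_pow_mul_measure_closedBall_le {w : F} (hw0 : 0 < ‖w‖) (hw1 : ‖w‖ < 1) (k : ℕ) :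
    2 ^ k * μ (Metric.closedBall 0 (‖w‖ ^ k)) ≤ μ (Metric.closedBall 0 1) := by
  induction k with
  | zero => simp
  | succ k ih =>
    refine le_trans ?_ ih
    rw [pow_succ, mul_assoc]
    gcongr
    have hlt : ‖w‖ ^ (k + 1) < ‖w‖ ^ k := by
      rw [pow_succ]; exact mul_lt_of_lt_one_right (pow_pos hw0 _) hw1
    have hdisj : Disjoint (Metric.closedBall (0 : F) (‖w‖ ^ (k + 1)))
        (Metric.closedBall (w ^ k) (‖w‖ ^ (k + 1))) := by
      rw [Set.disjoint_left]
      intro y hy hy'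
      have h1 : dist (w ^ k) 0 ≤ ‖w‖ ^ (k + 1) :=
        (dist_triangle_max _ y _).trans (max_le (by rw [dist_comm]; exact hy') hy)
      rw [dist_zero_right, norm_pow] at h1
      exact absurd h1 (not_le.2 hlt)
    rw [two_mul]
    nth_rewrite 2 [← measure_closedBall_eq_zero_center μ (w ^ k)]
    rw [← measure_union hdisj Metric.isClosed_closedBall.measurableSet]
    refine measure_mono (Set.union_subset (Metric.closedBall_subset_closedBall hlt.le) ?_)
    intro y hy
    have h1 : dist y 0 ≤ max (dist y (w ^ k)) (dist (w ^ k) 0) := dist_triangle_max _ _ _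
    refine h1.trans (max_le (hy.trans hlt.le) (by simp))

/-- The sublevel sets of a polynomial of degree `d` are small. -/
theorem two_pow_mul_measure_sublevel_le {w : F} (hw0 : 0 < ‖w‖) (hw1 : ‖w‖ < 1)
    (P : Polynomial F) (hP : P ≠ 0) (hd : 0 < P.natDegree) (k : ℕ) :
    2 ^ k * μ {x | ‖P.eval x‖ ≤ (‖w‖ ^ k) ^ P.natDegree * ‖P.leadingCoeff‖} ≤
      P.natDegree * μ (Metric.closedBall 0 1) := by
  have hη : 0 < ‖w‖ ^ k := pow_pos hw0 _
  obtain ⟨T, hTc, hT⟩ := exists_finset_card_le_subset_iUnion_closedBall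
    {x | ‖P.eval x‖ ≤ (‖w‖ ^ k) ^ P.natDegree * ‖P.leadingCoeff‖} (‖w‖ ^ k) hη.le P.natDegree
    (fun T hTS hsep => card_le_natDegree_of_separated P hP hd hη T hTS hsep)
  calc _ ≤ 2 ^ k * ∑ x ∈ T, μ (Metric.closedBall x (‖w‖ ^ k)) := by
        gcongr
        exact (measure_mono hT).trans (measure_biUnion_finset_le _ _)
    _ = T.card * (2 ^ k * μ (Metric.closedBall 0 (‖w‖ ^ k))) := by
        simp only [measure_closedBall_eq_zero_center μ _ (‖w‖ ^ k), Finset.sum_const, nsmul_eq_mul]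
        ring
    _ ≤ _ := by
        gcongr
        exact two_pow_mul_measure_closedBall_le μ hw0 hw1 k

end OneVariable

section Pointwise

/-- A negative power is dominated by a series of multiples of indicators of sublevel sets. -/
theorem enorm_rpow_neg_le_tsum_indicator {F : Type*} [NormedField F] {θ : ℝ} (hθ0 : 0 < θ)
    (hθ1 : θ < 1) {s : ℝ} (hs : 0 < s) (z c : F) (hc : c ≠ 0) :
    ‖z‖ₑ ^ (-s) ≤ ‖c‖ₑ ^ (-s) *
      (1 + ∑' k : ℕ, (ENNReal.ofReal θ ^ (-s)) ^ (k + 1) *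
        {y : F | ‖y‖ ≤ θ ^ k * ‖c‖}.indicator 1 z) := by
  have hc0 : 0 < ‖c‖ := norm_pos_iff.2 hc
  have hce : ‖c‖ₑ ≠ 0 := by simpa using hc
  have hb : 1 ≤ ENNReal.ofReal θ ^ (-s) := by
    rw [ENNReal.rpow_neg, ENNReal.one_le_inv]
    exact ENNReal.rpow_le_one (by simpa using hθ1.le) hs.le
  have hcne : ‖c‖ₑ ^ (-s) ≠ 0 := by
    rw [Ne, ENNReal.rpow_eq_zero_iff]; simp [hce]
  rcases eq_or_ne z 0 with rfl | hz
  -- At `z = 0` the left side is `∞`, and so is the series, all of whose terms are at least `1`.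
  · have : ∑' k : ℕ, (ENNReal.ofReal θ ^ (-s)) ^ (k + 1) *
        {y : F | ‖y‖ ≤ θ ^ k * ‖c‖}.indicator 1 (0 : F) = ∞ := by
      refine top_unique (le_trans ?_ (ENNReal.tsum_le_tsum (f := fun _ : ℕ => (1 : ℝ≥0∞)) ?_))
      · simp
      · intro k
        rw [Set.indicator_of_mem (by simp; positivity)]
        simpa using one_le_pow₀ hb
    rw [this]; simp [hcne]
  rcases lt_or_ge ‖c‖ ‖z‖ with h | h
  · calc ‖z‖ₑ ^ (-s) ≤ ‖c‖ₑ ^ (-s) * 1 := by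
          rw [mul_one, ENNReal.rpow_neg, ENNReal.rpow_neg, ENNReal.inv_le_inv]
          exact ENNReal.rpow_le_rpow (enorm_le_iff_norm_le.2 h.le) hs.le
      _ ≤ _ := by gcongr; exact le_self_add
  -- `k` is chosen with `θ ^ (k + 1) < ‖z‖ / ‖c‖ ≤ θ ^ k`; the `k`-th term alone dominates.
  · obtain ⟨k, hk1, hk2⟩ := exists_nat_pow_near_of_lt_one (x := ‖z‖ / ‖c‖) (y := θ)
      (div_pos (norm_pos_iff.2 hz) hc0) ((div_le_one hc0).2 h) hθ0 hθ1
    rw [div_le_iff₀ hc0] at hk2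
    rw [lt_div_iff₀ hc0] at hk1
    calc ‖z‖ₑ ^ (-s) ≤ (ENNReal.ofReal θ ^ (k + 1) * ‖c‖ₑ) ^ (-s) := by
          rw [ENNReal.rpow_neg, ENNReal.rpow_neg, ENNReal.inv_le_inv]
          refine ENNReal.rpow_le_rpow ?_ hs.le
          rw [← ofReal_norm, ← ofReal_norm, ← ENNReal.ofReal_pow hθ0.le,
            ← ENNReal.ofReal_mul (by positivity)]
          exact ENNReal.ofReal_le_ofReal hk1.le
      _ = ‖c‖ₑ ^ (-s) * (ENNReal.ofReal θ ^ (-s)) ^ (k + 1) := by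
          rw [ENNReal.mul_rpow_of_ne_zero (by simp [hθ0]) hce, mul_comm, ← ENNReal.rpow_natCast,
            ← ENNReal.rpow_natCast, ← ENNReal.rpow_mul, ← ENNReal.rpow_mul, mul_comm (-s)]
      _ ≤ _ := by
          gcongr
          refine le_trans ?_ (le_trans (ENNReal.le_tsum k) le_add_self)
          rw [Set.indicator_of_mem (s := {y : F | ‖y‖ ≤ θ ^ k * ‖c‖}) hk2]; simp

end Pointwise

section OneVariable

variable {F : Type*} [NontriviallyNormedField F] [MeasurableSpace F] [BorelSpace F]
  (μ : Measure F) [μ.IsAddHaarMeasure] [IsUltrametricDist F]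

/-- The power tends to `1` as `s → 0`. Any bound below `2` would do: the growth of the integrand
must lose against the halving of the measure. -/
theorem exists_pos_forall_rpow_neg_le {θ : ℝ} (hθ0 : 0 < θ) :
    ∃ s₀ : ℝ, 0 < s₀ ∧ ∀ s, 0 < s → s ≤ s₀ → ENNReal.ofReal θ ^ (-s) ≤ 3 / 2 := by
  have h1 : Filter.Tendsto (fun s : ℝ => θ ^ (-s)) (𝓝 0) (𝓝 1) := by
    have : Continuous (fun s : ℝ => θ ^ (-s)) := by
      exact Continuous.rpow continuous_const continuous_neg (fun _ => Or.inl hθ0.ne')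
    simpa using this.tendsto 0
  have h2 := h1.eventually (eventually_lt_nhds (by norm_num : (1 : ℝ) < 3 / 2))
  obtain ⟨ε, hε, h3⟩ := Metric.eventually_nhds_iff.1 h2
  refine ⟨ε / 2, by positivity, fun s hs hs' => ?_⟩
  have := h3 (y := s) (by rw [Real.dist_eq, sub_zero, abs_of_pos hs]; linarith)
  rw [ENNReal.ofReal_rpow_of_pos hθ0]
  calc _ ≤ ENNReal.ofReal (3 / 2) := ENNReal.ofReal_le_ofReal this.le
    _ = 3 / 2 := by rw [ENNReal.ofReal_div_of_pos (by norm_num)]; norm_num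

/-- Negative powers with small exponent of a one-variable polynomial are locally integrable, with a
bound that depends only on the degree and the leading coefficient. -/
theorem exists_lintegral_polynomial_rpow_neg_le [ProperSpace F] (d : ℕ) :
    ∃ s₀ : ℝ, 0 < s₀ ∧ ∀ s, 0 < s → s ≤ s₀ → ∀ K : Set F, μ K ≠ ∞ →
      ∃ C : ℝ≥0∞, C ≠ ∞ ∧ ∀ P : Polynomial F, P ≠ 0 → P.natDegree = d →
        ∫⁻ x in K, ‖P.eval x‖ₑ ^ (-s) ∂μ ≤ C * ‖P.leadingCoeff‖ₑ ^ (-s) := by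
  rcases Nat.eq_zero_or_pos d with rfl | hd
  · refine ⟨1, one_pos, fun s hs _ K hK => ⟨μ K, hK, fun P hP hPd => ?_⟩⟩
    rw [Polynomial.eq_C_of_natDegree_eq_zero hPd]
    simp [mul_comm]
  obtain ⟨w, hw0, hw1⟩ := NormedField.exists_norm_lt_one F
  -- The ratio `‖w‖ ^ d` makes the level `(‖w‖ ^ d) ^ k * ‖c‖` correspond to covering balls of
  -- radius `‖w‖ ^ k`.
  have hθ0 : 0 < ‖w‖ ^ d := pow_pos hw0 _
  have hθ1 : ‖w‖ ^ d < 1 := pow_lt_one₀ hw0.le hw1 hd.ne'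
  obtain ⟨s₀, hs₀, hs₀'⟩ := exists_pos_forall_rpow_neg_le hθ0
  refine ⟨s₀, hs₀, fun s hs hss K hK => ?_⟩
  set b := ENNReal.ofReal (‖w‖ ^ d) ^ (-s) with hbdef
  have hb : b ≤ 3 / 2 := hs₀' s hs hss
  have hbt : b ≠ ∞ := (hb.trans_lt (ENNReal.div_lt_top (by simp) (by simp))).ne
  refine ⟨μ K + ∑' k : ℕ, b ^ (k + 1) * ((2 ^ k)⁻¹ * (d * μ (Metric.closedBall 0 1))),
    ?_, fun P hP hPd => ?_⟩
  · refine ENNReal.add_ne_top.2 ⟨hK, ?_⟩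
    -- A geometric series of ratio `b / 2 ≤ 3 / 4`.
    have : ∀ k : ℕ, b ^ (k + 1) * ((2 ^ k)⁻¹ * (d * μ (Metric.closedBall 0 1))) =
        (b * (d * μ (Metric.closedBall 0 1))) * (b / 2) ^ k := by
      intro k
      rw [div_eq_mul_inv, mul_pow, ENNReal.inv_pow, pow_succ]; ring
    simp_rw [this]
    rw [ENNReal.tsum_mul_left, ENNReal.tsum_geometric]
    refine ENNReal.mul_ne_top (ENNReal.mul_ne_top hbt (ENNReal.mul_ne_top (by simp) ?_)) ?_
    · exact (isCompact_closedBall _ _).measure_ne_top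
    · rw [ENNReal.inv_ne_top]
      refine (tsub_pos_of_lt ?_).ne'
      rw [ENNReal.div_lt_iff (by simp) (by simp), one_mul]
      refine hb.trans_lt ?_
      rw [ENNReal.div_lt_iff (by simp) (by simp)]; norm_num
  · have hc : P.leadingCoeff ≠ 0 := by simpa using hP
    have hmeas : ∀ k : ℕ, MeasurableSet {x : F | ‖P.eval x‖ ≤ (‖w‖ ^ d) ^ k * ‖P.leadingCoeff‖} :=
      fun k => (isClosed_le (by fun_prop) continuous_const).measurableSet
    calc ∫⁻ x in K, ‖P.eval x‖ₑ ^ (-s) ∂μ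
        ≤ ∫⁻ x in K, ‖P.leadingCoeff‖ₑ ^ (-s) * (1 + ∑' k : ℕ, b ^ (k + 1) *
          {x : F | ‖P.eval x‖ ≤ (‖w‖ ^ d) ^ k * ‖P.leadingCoeff‖}.indicator 1 x) ∂μ :=
          lintegral_mono fun x => enorm_rpow_neg_le_tsum_indicator hθ0 hθ1 hs _ _ hc
      _ = ‖P.leadingCoeff‖ₑ ^ (-s) * (μ K + ∑' k : ℕ, b ^ (k + 1) *
          μ.restrict K {x : F | ‖P.eval x‖ ≤ (‖w‖ ^ d) ^ k * ‖P.leadingCoeff‖}) := by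
          have hm : ∀ k : ℕ, Measurable (fun x => b ^ (k + 1) *
              {x : F | ‖P.eval x‖ ≤ (‖w‖ ^ d) ^ k * ‖P.leadingCoeff‖}.indicator
                (1 : F → ℝ≥0∞) x) := fun k =>
            (measurable_one.indicator (hmeas k)).const_mul _
          have hsum : Measurable fun x => 1 + ∑' k : ℕ, b ^ (k + 1) *
              {x : F | ‖P.eval x‖ ≤ (‖w‖ ^ d) ^ k * ‖P.leadingCoeff‖}.indicator
                (1 : F → ℝ≥0∞) x := measurable_const.add (Measurable.tsum hm)
          rw [lintegral_const_mul _ hsum, lintegral_add_left measurable_const,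
            lintegral_tsum (fun k => (hm k).aemeasurable)]
          simp_rw [lintegral_const_mul _ (measurable_one.indicator (hmeas _)),
            lintegral_indicator_one (hmeas _)]
          simp
      _ ≤ _ := by
          rw [mul_comm]
          gcongr with k
          refine (Measure.restrict_apply_le _ _).trans ?_
          have := two_pow_mul_measure_sublevel_le μ hw0 hw1 P hP (hPd ▸ hd) k
          rw [hPd, ← pow_mul, mul_comm k d, pow_mul] at this
          rw [← ENNReal.div_eq_inv_mul, ENNReal.le_div_iff_mul_le (by simp) (by simp), mul_comm]
          exact this

end OneVariable

/-! ### Negative powers of polynomials in several variables. -/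

section SeveralVariables

variable {F : Type*} [NontriviallyNormedField F] [MeasurableSpace F] [BorelSpace F]
  (μ : Measure F) [μ.IsAddHaarMeasure] [ProperSpace F]

theorem measurable_enorm_eval_rpow {n : ℕ} (p : MvPolynomial (Fin n) F) (s : ℝ) :
    Measurable fun y : Fin n → F => ‖MvPolynomial.eval y p‖ₑ ^ s :=
  (MvPolynomial.continuous_eval p).measurable.enorm.pow_const s

theorem setLIntegral_pi_succ {F : Type*} [MeasurableSpace F] (μ : Measure F) [SigmaFinite μ]
    {n : ℕ} (K : Set F)
    (f : (Fin (n + 1) → F) → ℝ≥0∞) (hf : Measurable f) :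
    ∫⁻ y in Set.pi Set.univ (fun _ => K), f y ∂(Measure.pi fun _ : Fin (n + 1) => μ) =
      ∫⁻ y in Set.pi Set.univ (fun _ => K), ∫⁻ x in K, f (Fin.cons x y) ∂μ
        ∂(Measure.pi fun _ : Fin n => μ) := by
  have hmp := (measurePreserving_piFinSuccAbove (fun _ : Fin (n + 1) => μ) 0).symm
  rw [← hmp.setLIntegral_comp_preimage_emb (MeasurableEquiv.measurableEmbedding _)]
  have hset : (MeasurableEquiv.piFinSuccAbove (fun _ : Fin (n + 1) => F) 0).symm ⁻¹'
      (Set.pi Set.univ (fun _ => K)) = K ×ˢ (Set.pi Set.univ (fun _ : Fin n => K)) := by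
    ext ⟨x, y⟩
    simp [MeasurableEquiv.piFinSuccAbove, Fin.forall_fin_succ]
  rw [hset, ← Measure.prod_restrict, lintegral_prod_symm]
  · simp [MeasurableEquiv.piFinSuccAbove, Fin.consEquiv]
  · exact (hf.comp (MeasurableEquiv.measurable _)).aemeasurable

/-- A negative power with small exponent of a nonzero polynomial is locally integrable. -/
theorem exists_setLIntegral_mvPolynomial_rpow_neg_lt_top [IsUltrametricDist F] (n : ℕ)
    (p : MvPolynomial (Fin n) F) (hp : p ≠ 0) :
    ∃ s₀ : ℝ, 0 < s₀ ∧ ∀ s, 0 < s → s ≤ s₀ → ∀ K : Set F, μ K ≠ ∞ →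
      ∫⁻ y in Set.pi Set.univ (fun _ => K), ‖MvPolynomial.eval y p‖ₑ ^ (-s)
        ∂(Measure.pi fun _ : Fin n => μ) < ∞ := by
  induction n with
  | zero =>
    refine ⟨1, one_pos, fun s hs _ K hK => ?_⟩
    obtain ⟨c, rfl⟩ := MvPolynomial.C_surjective (Fin 0) p
    have hc : c ≠ 0 := by rintro rfl; simp at hp
    simp only [MvPolynomial.eval_C, lintegral_const]
    refine ENNReal.mul_lt_top ?_ (by simp)
    rw [lt_top_iff_ne_top, Ne, ENNReal.rpow_eq_top_iff]
    simp [hc]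
  | succ n ih =>
    set P := MvPolynomial.finSuccEquiv F n p with hPdef
    have hP : P ≠ 0 := by simpa [hPdef] using hp
    obtain ⟨s₁, hs₁, h₁⟩ := ih P.leadingCoeff (by simpa using hP)
    obtain ⟨s₂, hs₂, h₂⟩ := exists_lintegral_polynomial_rpow_neg_le μ P.natDegree
    refine ⟨min s₁ s₂, lt_min hs₁ hs₂, fun s hs hss K hK => ?_⟩
    obtain ⟨C, hC, hCP⟩ := h₂ s hs (hss.trans (min_le_right _ _)) K hK
    rw [setLIntegral_pi_succ μ K _ (measurable_enorm_eval_rpow p _)]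
    -- `C + 1` rather than `C`: where the leading coefficient vanishes the bound must be `∞`, which
    -- `0 * ∞` is not.
    calc _ ≤ ∫⁻ y in Set.pi Set.univ (fun _ => K), (C + 1) *
            ‖MvPolynomial.eval y P.leadingCoeff‖ₑ ^ (-s) ∂(Measure.pi fun _ : Fin n => μ) := by
          refine lintegral_mono fun y => ?_
          by_cases hy : MvPolynomial.eval y P.leadingCoeff = 0
          · simp [hy, hs]
          have hlc := Polynomial.leadingCoeff_map_of_leadingCoeff_ne_zero (MvPolynomial.eval y) hy
          have hdeg := Polynomial.natDegree_map_of_leadingCoeff_ne_zero (MvPolynomial.eval y) hy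
          have := hCP (P.map (MvPolynomial.eval y)) (fun h => by
            rw [h, Polynomial.leadingCoeff_zero] at hlc; exact hy hlc.symm) hdeg
          rw [hlc] at this
          simp_rw [MvPolynomial.eval_eq_eval_mv_eval', ← hPdef]
          refine this.trans ?_
          gcongr
          exact le_self_add
      _ < ∞ := by
          rw [lintegral_const_mul _ (measurable_enorm_eval_rpow _ _)]
          exact ENNReal.mul_lt_top (by simpa [lt_top_iff_ne_top] using hC)
            (h₁ s hs (hss.trans (min_le_left _ _)) K hK)

end SeveralVariables

/-- A negative power with small exponent of a nonzero polynomial is integrable on compact sets for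
the normalized Haar measure. -/
theorem exists_setLIntegral_haar_rpow_neg_lt_top {F : Type u} [NontriviallyNormedField F]
    [IsUltrametricDist F] [LocallyCompactSpace F] [MeasurableSpace F] [BorelSpace F]
    {n : ℕ} (p : MvPolynomial (Fin n) F) (hp : p ≠ 0) :
    ∃ s : ℝ≥0, 0 < s ∧ ∀ L : Set (Fin n → F), IsCompact L →
      ∫⁻ y in L, ‖MvPolynomial.eval y p‖ₑ ^ (-(s : ℝ)) ∂(haar F n) < ∞ := by
  have : ProperSpace F := ProperSpace.of_locallyCompactSpace F
  let μ : Measure F := Measure.addHaar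
  obtain ⟨s₀, hs₀, h⟩ := exists_setLIntegral_mvPolynomial_rpow_neg_lt_top μ n p hp
  refine ⟨⟨s₀, hs₀.le⟩, hs₀, fun L hL => ?_⟩
  obtain ⟨R, hR⟩ := hL.isBounded.subset_closedBall 0
  have hsub : L ⊆ Set.pi Set.univ (fun _ => Metric.closedBall (0 : F) (max R 0)) := by
    refine hR.trans ((Metric.closedBall_subset_closedBall (le_max_left R 0)).trans ?_)
    rw [closedBall_pi _ (le_max_right R 0)]
    rfl
  have : (haar F n).IsAddHaarMeasure := by unfold haar; infer_instance
  have hsmul := Measure.isAddLeftInvariant_eq_smul (haar F n) (Measure.pi fun _ : Fin n => μ)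
  rw [hsmul, Measure.restrict_smul, lintegral_smul_measure]
  refine ENNReal.mul_lt_top (by simp) ((lintegral_mono_set hsub).trans_lt ?_)
  exact h s₀ hs₀ le_rfl _ (isCompact_closedBall _ _).measure_ne_top

/-! ### Commutative algebra of quasi-finite and étale algebras. -/

/-- An ideal of a quasi-finite algebra over a domain that is contained in no minimal prime contains
the image of a nonzero element of the domain. -/
theorem exists_ne_zero_algebraMap_mem {A B : Type*} [CommRing A] [IsDomain A] [CommRing B]
    [Algebra A B] [Algebra.QuasiFinite A B] (I : Ideal B)
    (hI : ∀ Q ∈ minimalPrimes B, ¬ I ≤ Q) : ∃ a : A, a ≠ 0 ∧ algebraMap A B a ∈ I := by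
  by_contra! hcon
  have hdisj : Disjoint (I : Set B) (Algebra.algebraMapSubmonoid B (nonZeroDivisors A)) := by
    rw [Set.disjoint_left]
    rintro _ hb ⟨a, ha, rfl⟩
    exact hcon a (nonZeroDivisors.ne_zero ha) hb
  obtain ⟨Q, hQ, hIQ, hQd⟩ := Ideal.exists_le_prime_disjoint I _ hdisj
  have hunder : Q.under A = ⊥ := by
    rw [eq_bot_iff]
    intro a ha
    by_contra ha0
    exact Set.disjoint_left.1 hQd ha ⟨a, mem_nonZeroDivisors_of_ne_zero ha0, rfl⟩
  obtain ⟨Q', hQ', hle⟩ := Ideal.exists_minimalPrimes_le (I := (⊥ : Ideal B)) (J := Q) bot_le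
  have : Q'.IsPrime := hQ'.1.1
  have hunder' : Q'.under A = ⊥ := by
    rw [eq_bot_iff, ← hunder]; exact Ideal.comap_mono hle
  -- Distinct primes in one fibre of a quasi-finite algebra are incomparable; so `Q`, which contains
  -- `I`, is itself minimal.
  have heq := Algebra.QuasiFinite.eq_of_le_of_under_eq (R := A) Q' Q hle (hunder'.trans hunder.symm)
  exact hI Q (heq ▸ hQ') hIQ

/-- An étale algebra has a presentation with as many variables as relations and invertible
Jacobian. -/
theorem exists_submersivePresentation_map_eq_id (A B : Type*) [CommRing A] [CommRing B]
    [Algebra A B] [Algebra.Etale A B] :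
    ∃ (σ : Type) (_ : Finite σ) (P : Algebra.SubmersivePresentation A B σ σ), P.map = id := by
  obtain ⟨ι, σ, _, _, P, hP⟩ := Algebra.Etale.iff_isStandardSmoothOfRelativeDimension_zero.1
    ‹Algebra.Etale A B›
  -- Relative dimension `0` is a truncated difference and gives only this inequality; injectivity of
  -- `P.map` gives the other.
  have hcard : Nat.card ι ≤ Nat.card σ := Nat.sub_eq_zero_iff_le.1 hP
  have hbij : Function.Bijective P.map :=
    (Nat.bijective_iff_injective_and_card _).2 ⟨P.map_inj, le_antisymm
      (Nat.card_le_card_of_injective _ P.map_inj) hcard⟩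
  refine ⟨σ, inferInstance, P.reindex (Equiv.ofBijective _ hbij) (Equiv.refl _), ?_⟩
  ext j
  simp [Algebra.SubmersivePresentation.reindex, Algebra.PreSubmersivePresentation.reindex]

/-- An étale algebra is the quotient of a polynomial ring by as many relations as there are
variables, with invertible Jacobian determinant. -/
theorem exists_surjective_ker_eq_span_isUnit_jacobian (A B : Type*) [CommRing A] [CommRing B]
    [Algebra A B] [Algebra.Etale A B] :
    ∃ (σ : Type) (_ : Fintype σ) (_ : DecidableEq σ) (g : σ → MvPolynomial σ A)
      (θ : MvPolynomial σ A →ₐ[A] B), Function.Surjective θ ∧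
        RingHom.ker θ = Ideal.span (Set.range g) ∧
        IsUnit (θ (Matrix.of fun j i => MvPolynomial.pderiv i (g j)).det) := by
  classical
  obtain ⟨σ, _, P, hP⟩ := exists_submersivePresentation_map_eq_id A B
  have := Fintype.ofFinite σ
  refine ⟨σ, this, inferInstance, P.relation, MvPolynomial.aeval P.val,
    fun b => ⟨_, P.aeval_val_σ b⟩, ?_, ?_⟩
  · rw [P.span_range_relation_eq_ker]
    ext p
    rw [RingHom.mem_ker, Algebra.Generators.ker_eq_ker_aeval_val, RingHom.mem_ker]
  · have h := P.jacobian_isUnit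
    rw [Algebra.PreSubmersivePresentation.jacobian_eq_jacobiMatrix_det, P.algebraMap_eq] at h
    have hM : (Matrix.of fun j i => MvPolynomial.pderiv i (P.relation j)) =
        P.jacobiMatrix.transpose := by
      ext i j : 2
      simp [Algebra.PreSubmersivePresentation.jacobiMatrix_apply, hP]
    rw [hM, Matrix.det_transpose]
    exact h

/-! ### The relations as an analytic map, and its local inverse. -/

section Evaluation

variable {F : Type*} [NontriviallyNormedField F] {n : ℕ} {σ : Type*}

/-- Evaluation of a polynomial whose coefficients are polynomials in further variables. -/
def evalPair (z : (Fin n → F) × (σ → F)) : MvPolynomial σ (MvPolynomial (Fin n) F) →+* F :=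
  MvPolynomial.eval₂Hom (MvPolynomial.eval z.1) z.2

variable [Fintype σ]

theorem analyticAt_evalPair (p : MvPolynomial σ (MvPolynomial (Fin n) F))
    (z : (Fin n → F) × (σ → F)) : AnalyticAt F (fun w => evalPair w p) z := by
  induction p using MvPolynomial.induction_on with
  | C c =>
    simp only [evalPair, MvPolynomial.coe_eval₂Hom, MvPolynomial.eval₂_C]
    exact AnalyticAt.aeval_mvPolynomial (f := fun w : (Fin n → F) × (σ → F) => w.1)
      (fun i => ((ContinuousLinearMap.proj i).comp (ContinuousLinearMap.fst F _ _)).analyticAt z) c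
  | add p q hp hq => simp only [map_add]; exact hp.add hq
  | mul_X p i hp =>
    simp only [map_mul]
    refine hp.mul ?_
    simp only [evalPair, MvPolynomial.coe_eval₂Hom, MvPolynomial.eval₂_X]
    exact ((ContinuousLinearMap.proj i).comp (ContinuousLinearMap.snd F _ _)).analyticAt z

theorem fderiv_evalPair_inr (p : MvPolynomial σ (MvPolynomial (Fin n) F))
    (z : (Fin n → F) × (σ → F)) (v : σ → F) :
    fderiv F (fun w => evalPair w p) z (0, v) =
      ∑ i, evalPair z (MvPolynomial.pderiv i p) * v i := by
  classical
  have hd : ∀ q : MvPolynomial σ (MvPolynomial (Fin n) F),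
      DifferentiableAt F (fun w => evalPair w q) z :=
    fun q => (analyticAt_evalPair q z).differentiableAt
  induction p using MvPolynomial.induction_on with
  | C c =>
    have h1 : HasFDerivAt (fun w : (Fin n → F) × (σ → F) => MvPolynomial.eval w.1 c)
        ((fderiv F (fun t => MvPolynomial.eval t c) z.1).comp (ContinuousLinearMap.fst F _ _)) z := by
      refine HasFDerivAt.comp (g := fun t => MvPolynomial.eval t c) z ?_ hasFDerivAt_fst
      exact (AnalyticAt.aeval_mvPolynomial (f := fun w : (Fin n → F) => w)
        (fun i => (ContinuousLinearMap.proj (R := F) (φ := fun _ : Fin n => F) i).analyticAt _)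
          c).differentiableAt.hasFDerivAt
    have h2 : (fun w : (Fin n → F) × (σ → F) => evalPair w (MvPolynomial.C c)) =
        fun w => MvPolynomial.eval w.1 c := by
      ext w; simp [evalPair]
    rw [h2, h1.fderiv]
    simp
  | add p q hp hq =>
    simp only [map_add]
    rw [fderiv_fun_add (hd p) (hd q)]
    simp [hp, hq, add_mul, Finset.sum_add_distrib]
  | mul_X p i hp =>
    have h2 : (fun w : (Fin n → F) × (σ → F) => evalPair w (MvPolynomial.X i)) =
        ((ContinuousLinearMap.proj i).comp (ContinuousLinearMap.snd F (Fin n → F) (σ → F)) :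
          (Fin n → F) × (σ → F) →L[F] F) := by
      ext w; simp [evalPair]
    have h3 := fderiv_fun_mul (hd p) (hd (MvPolynomial.X i))
    rw [h2, ContinuousLinearMap.fderiv] at h3
    simp only [map_mul]
    rw [h3]
    simp only [_root_.add_apply, _root_.smul_apply, hp]
    simp only [MvPolynomial.pderiv_mul, MvPolynomial.pderiv_X, map_add, map_mul, add_mul,
      Finset.sum_add_distrib]
    simp [evalPair, Pi.single_apply, apply_ite, Finset.mul_sum, mul_comm, mul_left_comm, add_comm]

end Evaluation

section InverseFunction

variable {F : Type*} [NontriviallyNormedField F] {n : ℕ} {σ : Type*} [Fintype σ]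
  (g : σ → MvPolynomial σ (MvPolynomial (Fin n) F))

/-- The map whose fibre over `(t, 0)` is the set of the solutions of the relations `g` over `t`. -/
def relMap (z : (Fin n → F) × (σ → F)) : (Fin n → F) × (σ → F) := (z.1, fun j => evalPair z (g j))

theorem analyticAt_relMap (z : (Fin n → F) × (σ → F)) : AnalyticAt F (relMap g) z :=
  analyticAt_fst.prod (AnalyticAt.pi fun j => analyticAt_evalPair (g j) z)

variable [DecidableEq σ]

/-- The Jacobian determinant of the relations `g` in the second group of variables. -/
def relJacobian (z : (Fin n → F) × (σ → F)) : F :=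
  (Matrix.of fun j i => evalPair z (MvPolynomial.pderiv i (g j))).det

variable [CompleteSpace F]

/-- The derivative is block triangular, with the identity and the Jacobian matrix on the diagonal.
It is therefore injective, which suffices in finite dimension. -/
theorem exists_continuousLinearEquiv_fderiv_relMap {z : (Fin n → F) × (σ → F)}
    (hz : relJacobian g z ≠ 0) :
    ∃ i : ((Fin n → F) × (σ → F)) ≃L[F] ((Fin n → F) × (σ → F)),
      (i : ((Fin n → F) × (σ → F)) →L[F] ((Fin n → F) × (σ → F))) = fderiv F (relMap g) z := by
  have hfd : fderiv F (relMap g) z = (ContinuousLinearMap.fst F _ _).prod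
      (ContinuousLinearMap.pi fun j => fderiv F (fun w => evalPair w (g j)) z) := by
    refine HasFDerivAt.fderiv (hasFDerivAt_fst.prodMk (hasFDerivAt_pi.2 fun j => ?_))
    exact (analyticAt_evalPair (g j) z).differentiableAt.hasFDerivAt
  have hinj : Function.Injective (fderiv F (relMap g) z) := by
    rw [injective_iff_map_eq_zero]
    rintro ⟨u, v⟩ huv
    rw [hfd] at huv
    simp only [ContinuousLinearMap.prod_apply, ContinuousLinearMap.coe_fst', Prod.mk_eq_zero] at huv
    obtain ⟨rfl, hv⟩ := huv
    have hmul : (Matrix.of fun j i => evalPair z (MvPolynomial.pderiv i (g j))).mulVec v = 0 := by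
      ext j
      have := congrFun hv j
      simp only [ContinuousLinearMap.pi_apply, fderiv_evalPair_inr] at this
      simpa [Matrix.mulVec, dotProduct] using this
    simp [Matrix.eq_zero_of_mulVec_eq_zero hz hmul]
  refine ⟨(LinearEquiv.ofInjectiveEndo (fderiv F (relMap g) z).toLinearMap
    hinj).toContinuousLinearEquiv, ?_⟩
  ext <;> rfl

/-- Analyticity of the inverse is stated at every target point with nonzero Jacobian, not just at
the image of `z₀`, because a chart must be analytic throughout its target. -/
theorem exists_openPartialHomeomorph_relMap {z₀ : (Fin n → F) × (σ → F)}
    (hz₀ : relJacobian g z₀ ≠ 0) :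
    ∃ Φ : OpenPartialHomeomorph ((Fin n → F) × (σ → F)) ((Fin n → F) × (σ → F)),
      z₀ ∈ Φ.source ∧ (∀ z, Φ z = relMap g z) ∧
      ∀ y ∈ Φ.target, relJacobian g (Φ.symm y) ≠ 0 → AnalyticAt F Φ.symm y := by
  obtain ⟨i, hi⟩ := exists_continuousLinearEquiv_fderiv_relMap g hz₀
  have hs : HasStrictFDerivAt (relMap g)
      (i : ((Fin n → F) × (σ → F)) →L[F] ((Fin n → F) × (σ → F))) z₀ := by
    rw [hi]; exact (analyticAt_relMap g z₀).hasStrictFDerivAt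
  refine ⟨hs.toOpenPartialHomeomorph _, hs.mem_toOpenPartialHomeomorph_source, fun z => rfl,
    fun y hy hJ => ?_⟩
  obtain ⟨i', hi'⟩ := exists_continuousLinearEquiv_fderiv_relMap g hJ
  exact OpenPartialHomeomorph.analyticAt_symm _ hy (analyticAt_relMap g _) hi'.symm

end InverseFunction

/-! ### Rational points as evaluation homomorphisms, and their topology. -/

section Points

variable {F : Type u} [Field F] {X : Scheme.{u}} {π : X ⟶ Spec (CommRingCat.of F)}

/-- The structure homomorphism of the algebra of regular functions on `V`. -/
def structHom (π : X ⟶ Spec (CommRingCat.of F)) (V : X.Opens) : F →+* Γ(X, V) :=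
  ((Scheme.ΓSpecIso (CommRingCat.of F)).inv ≫ π.appLE ⊤ V le_top).hom

/-- Evaluation of the regular functions on `V` at a rational point of `V`. -/
def RatPoint.evalHom (x : RatPoint π) (V : X.Opens) (h : x.MemOpen V) : Γ(X, V) →+* F :=
  (x.1.appLE V ⊤ h ≫ (Scheme.ΓSpecIso (CommRingCat.of F)).hom).hom

theorem regVal_eq_evalHom (x : RatPoint π) (V : X.Opens) (h : x.MemOpen V) (f : Γ(X, V)) :
    regVal π V f x = x.evalHom V h f := by
  rw [regVal, dif_pos h]; rfl

theorem RatPoint.MemOpen.mono {x : RatPoint π} {V W : X.Opens} (h : x.MemOpen V) (hVW : V ≤ W) :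
    x.MemOpen W :=
  le_trans (show ⊤ ≤ x.1 ⁻¹ᵁ V from h) (x.1.preimage_mono hVW)

theorem RatPoint.memOpen_top (x : RatPoint π) : x.MemOpen ⊤ := le_top

theorem RatPoint.evalHom_map (x : RatPoint π) {V W : X.Opens} (i : V ⟶ W) (h : x.MemOpen V)
    (f : Γ(X, W)) :
    x.evalHom V h (X.presheaf.map i.op f) = x.evalHom W (h.mono i.le) f := by
  have := x.1.map_appLE (show ⊤ ≤ x.1 ⁻¹ᵁ V from h) i.op
  have h2 := congr($(this) f)
  simp only [CommRingCat.comp_apply] at h2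
  simp only [RatPoint.evalHom, CommRingCat.hom_comp, RingHom.comp_apply]
  rw [← h2]

theorem RatPoint.evalHom_comp_structHom (x : RatPoint π) (V : X.Opens) (h : x.MemOpen V) :
    (x.evalHom V h).comp (structHom π V) = RingHom.id F := by
  have key : π.appLE ⊤ V le_top ≫ x.1.appLE V ⊤ h = 𝟙 _ := by
    have : ∀ (y : Spec (CommRingCat.of F) ⟶ Spec (CommRingCat.of F)) (_ : y = 𝟙 _)
        (e : ⊤ ≤ y ⁻¹ᵁ ⊤), y.appLE ⊤ ⊤ e = 𝟙 _ := by
      rintro _ rfl e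
      simp only [Scheme.Hom.appLE, Scheme.Hom.id_app]
      exact (Spec (CommRingCat.of F)).presheaf.map_id _
    exact (Scheme.Hom.appLE_comp_appLE x.1 π ⊤ V ⊤ le_top h).trans (this _ x.2 _)
  have : (Scheme.ΓSpecIso (CommRingCat.of F)).inv ≫ π.appLE ⊤ V le_top ≫ x.1.appLE V ⊤ h ≫
      (Scheme.ΓSpecIso (CommRingCat.of F)).hom = 𝟙 _ := by
    rw [reassoc_of% key, Iso.inv_hom_id]
  exact congr($(this).hom)

theorem RatPoint.eq_specMap_evalHom (x : RatPoint π) {V : X.Opens} (hV : IsAffineOpen V)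
    (h : x.MemOpen V) :
    x.1 = Spec.map (CommRingCat.ofHom (x.evalHom V h)) ≫ hV.fromSpec := by
  have key := IsAffineOpen.SpecMap_appLE_fromSpec x.1 hV
    (isAffineOpen_top (Spec (CommRingCat.of F))) h
  rw [IsAffineOpen.fromSpec_top, Scheme.isoSpec_Spec_inv] at key
  have h2 : CommRingCat.ofHom (x.evalHom V h) = x.1.appLE V ⊤ h ≫
      (Scheme.ΓSpecIso (CommRingCat.of F)).hom := rfl
  rw [h2, Spec.map_comp, Category.assoc, key, ← Spec.map_comp_assoc, Iso.inv_hom_id, Spec.map_id,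
    Category.id_comp]

theorem RatPoint.ext_of_evalHom_eq {x x' : RatPoint π} {V : X.Opens} (hV : IsAffineOpen V)
    (h : x.MemOpen V) (h' : x'.MemOpen V) (heq : x.evalHom V h = x'.evalHom V h') : x = x' := by
  apply Subtype.ext
  rw [x.eq_specMap_evalHom hV h, x'.eq_specMap_evalHom hV h', heq]

/-- With `RatPoint.ext_of_evalHom_eq`, this identifies `V(F)` with the `F`-algebra homomorphisms
`Γ(X, V) → F`. -/
theorem exists_ratPoint_evalHom_eq {V : X.Opens} (hV : IsAffineOpen V) (e : Γ(X, V) →+* F)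
    (he : e.comp (structHom π V) = RingHom.id F) :
    ∃ (x : RatPoint π) (h : x.MemOpen V), x.evalHom V h = e := by
  have hcomp : (Spec.map (CommRingCat.ofHom e) ≫ hV.fromSpec) ≫ π = 𝟙 _ := by
    have key := IsAffineOpen.SpecMap_appLE_fromSpec π
      (isAffineOpen_top (Spec (CommRingCat.of F))) hV le_top
    rw [IsAffineOpen.fromSpec_top, Scheme.isoSpec_Spec_inv] at key
    rw [Category.assoc, ← key, ← Spec.map_comp, ← Spec.map_comp, ← Spec.map_id]
    congr 1
    exact CommRingCat.hom_ext he
  let x : RatPoint π := ⟨_, hcomp⟩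
  have hx : x.MemOpen V := by
    intro z _
    change (Spec.map (CommRingCat.ofHom e) ≫ hV.fromSpec) z ∈ V
    rw [Scheme.Hom.comp_apply]
    exact hV.range_fromSpec.le ⟨_, rfl⟩
  refine ⟨x, hx, ?_⟩
  have h1 := x.eq_specMap_evalHom hV hx
  have h2 : Spec.map (CommRingCat.ofHom e) = Spec.map (CommRingCat.ofHom (x.evalHom V hx)) :=
    (cancel_mono hV.fromSpec).1 h1
  exact (congr($(Spec.map_inj.1 h2).hom)).symm

theorem RatPoint.memOpen_iff (x : RatPoint π) (V : X.Opens)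
    (z : Spec (CommRingCat.of F)) : x.MemOpen V ↔ x.1 z ∈ V := by
  refine ⟨fun h => h (x := z) trivial, fun h y _ => ?_⟩
  have : y = z := Subsingleton.elim (α := PrimeSpectrum F) y z
  rw [this]; exact h

theorem RatPoint.memOpen_basicOpen (x : RatPoint π) {V : X.Opens} (h : x.MemOpen V) (b : Γ(X, V)) :
    x.MemOpen (X.basicOpen b) ↔ x.evalHom V h b ≠ 0 := by
  constructor
  · intro hb
    have h1 : IsUnit (X.presheaf.map (homOfLE (X.basicOpen_le b)).op b) :=
      RingedSpace.isUnit_res_basicOpen _ b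
    have h2 := h1.map (x.evalHom _ hb)
    rw [x.evalHom_map] at h2
    exact h2.ne_zero
  · intro hb
    have h1 : IsUnit (x.1.appLE V ⊤ h b) := by
      have h3 : IsUnit ((Scheme.ΓSpecIso (CommRingCat.of F)).hom (x.1.appLE V ⊤ h b)) :=
        IsUnit.mk0 _ hb
      have h4 := h3.map (Scheme.ΓSpecIso (CommRingCat.of F)).inv.hom
      simpa using h4
    have h2 : (Spec (CommRingCat.of F)).basicOpen
        (((Spec (CommRingCat.of F)).presheaf.map (homOfLE h).op) (x.1.app V b)) = ⊤ :=
      Scheme.basicOpen_of_isUnit _ h1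
    rw [Scheme.basicOpen_res, top_inf_eq] at h2
    rw [RatPoint.MemOpen, Scheme.preimage_basicOpen]
    exact h2.ge

/-- Near a rational point of an affine open `V`, every regular function is a quotient of regular
functions on `V`. -/
theorem RatPoint.exists_regVal_eq_div (x : RatPoint π) {V W : X.Opens} (hV : IsAffineOpen V)
    (hxV : x.MemOpen V) (hxW : x.MemOpen W) (f : Γ(X, W)) :
    ∃ a b : Γ(X, V), x.evalHom V hxV b ≠ 0 ∧ ∀ (y : RatPoint π) (hy : y.MemOpen V),
      y.evalHom V hy b ≠ 0 → y.MemOpen W ∧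
        regVal π W f y = y.evalHom V hy a / y.evalHom V hy b := by
  let z : Spec (CommRingCat.of F) := (⊥ : PrimeSpectrum F)
  obtain ⟨b, hbW, hxb⟩ := hV.exists_basicOpen_le ⟨x.1 z, (x.memOpen_iff W z).1 hxW⟩
    ((x.memOpen_iff V z).1 hxV)
  have hbx := (x.memOpen_basicOpen hxV b).1 ((x.memOpen_iff _ z).2 hxb)
  have := hV.isLocalization_basicOpen b
  obtain ⟨k, a, hka⟩ := IsLocalization.Away.surj b (X.presheaf.map (homOfLE hbW).op f)
  -- The extra factor `b` makes nonvanishing of the denominator force `b ≠ 0` even when `k = 0`.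
  refine ⟨a * b, b ^ k * b, by
    rw [map_mul, map_pow]; exact mul_ne_zero (pow_ne_zero _ hbx) hbx, fun y hy hyb => ?_⟩
  have hyb' : y.evalHom V hy b ≠ 0 := fun h0 => hyb (by rw [map_mul, h0, mul_zero])
  have hyB : y.MemOpen (X.basicOpen b) := (y.memOpen_basicOpen hy b).2 hyb'
  have hyW := hyB.mono hbW
  refine ⟨hyW, ?_⟩
  have hres : ∀ c : Γ(X, V), y.evalHom _ hyB (algebraMap Γ(X, V) Γ(X, X.basicOpen b) c) =
      y.evalHom V hy c := fun c => y.evalHom_map (homOfLE (X.basicOpen_le b)) hyB c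
  have h1 := congrArg (y.evalHom _ hyB) hka
  rw [map_mul, map_pow, hres, hres, y.evalHom_map] at h1
  rw [regVal_eq_evalHom y W hyW, map_mul, map_mul, map_pow, ← h1]
  field_simp

end Points

section Topology

variable {F : Type u} [NontriviallyNormedField F] {X : Scheme.{u}}
  {π : X ⟶ Spec (CommRingCat.of F)}

theorem isOpen_setOf_memOpen (V : X.Opens) : IsOpen {x : RatPoint π | x.MemOpen V} :=
  TopologicalSpace.isOpen_generateFrom_of_mem ⟨V, 0, Set.univ, isOpen_univ, by simp⟩

theorem continuousOn_regVal (V : X.Opens) (f : Γ(X, V)) :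
    ContinuousOn (regVal π V f) {x | x.MemOpen V} := by
  rw [continuousOn_iff']
  intro W hW
  refine ⟨{x | x.MemOpen V ∧ regVal π V f x ∈ W},
    TopologicalSpace.isOpen_generateFrom_of_mem ⟨V, f, W, hW, rfl⟩, ?_⟩
  ext x
  simp only [Set.mem_inter_iff, Set.mem_preimage, Set.mem_ofPred_eq]
  tauto

end Topology

/-! ### Étale coordinates as analytic charts. -/

section Coordinates

variable {F : Type u} [NontriviallyNormedField F] {X : Scheme.{u}}
  {π : X ⟶ Spec (CommRingCat.of F)} {V : X.Opens} {n : ℕ} {σ : Type}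
  (θ : MvPolynomial σ (MvPolynomial (Fin n) F) →+* Γ(X, V))

/-- The coordinates on `V(F)` given by the variables of a polynomial ring mapping to `Γ(X, V)`. -/
def coord (π : X ⟶ Spec (CommRingCat.of F))
    (θ : MvPolynomial σ (MvPolynomial (Fin n) F) →+* Γ(X, V)) (x : RatPoint π) :
    (Fin n → F) × (σ → F) :=
  (fun i => regVal π V (θ (MvPolynomial.C (MvPolynomial.X i))) x,
    fun j => regVal π V (θ (MvPolynomial.X j)) x)

theorem continuousOn_coord : ContinuousOn (coord π θ) {x | x.MemOpen V} :=
  (continuousOn_pi.2 fun _ => continuousOn_regVal V _).prodMk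
    (continuousOn_pi.2 fun _ => continuousOn_regVal V _)

theorem evalPair_coord
    (hθ : ∀ c : F, θ (MvPolynomial.C (MvPolynomial.C c)) = structHom π V c)
    (x : RatPoint π) (hx : x.MemOpen V) :
    evalPair (coord π θ x) = (x.evalHom V hx).comp θ := by
  refine MvPolynomial.ringHom_ext' (MvPolynomial.ringHom_ext' ?_ fun i => ?_) fun j => ?_
  · ext c
    have := congr($(x.evalHom_comp_structHom V hx) c)
    simp only [RingHom.comp_apply, RingHom.id_apply] at this
    simp [evalPair, hθ, this]
  · simp [evalPair, coord, regVal_eq_evalHom x V hx]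
  · simp [evalPair, coord, regVal_eq_evalHom x V hx]

theorem eq_of_coord_eq
    (hθ : ∀ c : F, θ (MvPolynomial.C (MvPolynomial.C c)) = structHom π V c)
    (hV : IsAffineOpen V) (hsurj : Function.Surjective θ) {x y : RatPoint π}
    (hx : x.MemOpen V) (hy : y.MemOpen V) (h : coord π θ x = coord π θ y) : x = y := by
  refine RatPoint.ext_of_evalHom_eq hV hx hy (RingHom.ext fun b => ?_)
  obtain ⟨p, rfl⟩ := hsurj b
  have h1 := congr($(evalPair_coord θ hθ x hx) p)
  rw [h, evalPair_coord θ hθ y hy] at h1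
  exact h1.symm

/-- Evaluation at a common zero of the relations kills the kernel of `θ`, so it descends to `Γ(X,
V)` and defines a rational point. -/
theorem exists_coord_eq
    (hθ : ∀ c : F, θ (MvPolynomial.C (MvPolynomial.C c)) = structHom π V c)
    (hV : IsAffineOpen V) (hsurj : Function.Surjective θ)
    {g : σ → MvPolynomial σ (MvPolynomial (Fin n) F)}
    (hker : RingHom.ker θ = Ideal.span (Set.range g)) (z : (Fin n → F) × (σ → F))
    (hz : ∀ j, evalPair z (g j) = 0) :
    ∃ x : RatPoint π, x.MemOpen V ∧ coord π θ x = z := by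
  have hle : RingHom.ker θ ≤ RingHom.ker (evalPair z) := by
    rw [hker, Ideal.span_le]
    rintro _ ⟨j, rfl⟩
    exact hz j
  let e := RingHom.liftOfSurjective θ hsurj ⟨evalPair z, hle⟩
  have he : ∀ p, e (θ p) = evalPair z p := fun p =>
    RingHom.liftOfRightInverse_comp_apply θ _ _ ⟨evalPair z, hle⟩ p
  obtain ⟨x, hx, hxe⟩ := exists_ratPoint_evalHom_eq (π := π) hV e (by
    ext c
    rw [RingHom.comp_apply, ← hθ, he]
    simp [evalPair])
  refine ⟨x, hx, ?_⟩
  refine Prod.ext (funext fun i => ?_) (funext fun j => ?_)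
  · change regVal π V _ x = _
    rw [regVal_eq_evalHom x V hx, hxe, he]
    simp [evalPair]
  · change regVal π V _ x = _
    rw [regVal_eq_evalHom x V hx, hxe, he]
    simp [evalPair]

theorem evalPair_coord_eq_zero
    (hθ : ∀ c : F, θ (MvPolynomial.C (MvPolynomial.C c)) = structHom π V c)
    {g : σ → MvPolynomial σ (MvPolynomial (Fin n) F)}
    (hker : RingHom.ker θ = Ideal.span (Set.range g)) (x : RatPoint π) (hx : x.MemOpen V) (j : σ) :
    evalPair (coord π θ x) (g j) = 0 := by
  have : θ (g j) = 0 := by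
    rw [← RingHom.mem_ker, hker]; exact Ideal.subset_span ⟨j, rfl⟩
  rw [evalPair_coord θ hθ x hx, RingHom.comp_apply, this, map_zero]

theorem relJacobian_coord_ne_zero
    (hθ : ∀ c : F, θ (MvPolynomial.C (MvPolynomial.C c)) = structHom π V c)
    [Fintype σ] [DecidableEq σ]
    {g : σ → MvPolynomial σ (MvPolynomial (Fin n) F)}
    (hJ : IsUnit (θ (Matrix.of fun j i => MvPolynomial.pderiv i (g j)).det))
    (x : RatPoint π) (hx : x.MemOpen V) : relJacobian g (coord π θ x) ≠ 0 := by
  have h := hJ.map (x.evalHom V hx)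
  rw [← RingHom.comp_apply, ← evalPair_coord θ hθ x hx, RingHom.map_det] at h
  exact h.ne_zero

end Coordinates

section Chart

variable {F : Type u} [NontriviallyNormedField F] [CompleteSpace F] {X : Scheme.{u}}
  {π : X ⟶ Spec (CommRingCat.of F)} {V : X.Opens} {n : ℕ}

/-- Étale coordinates on an affine open set are an analytic chart near every rational point. -/
theorem exists_analyticChart_of_etale (hV : IsAffineOpen V)
    (τ : MvPolynomial (Fin n) F →+* Γ(X, V)) (hτ : τ.Etale)
    (hτC : τ.comp MvPolynomial.C = structHom π V) (x₀ : RatPoint π) (hx₀ : x₀.MemOpen V) :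
    ∃ ψ ∈ analyticCharts π n, x₀ ∈ ψ.source ∧ (∀ x ∈ ψ.source, x.MemOpen V) ∧
      ∀ x i, ψ x i = regVal π V (τ (MvPolynomial.X i)) x := by
  classical
  let := τ.toAlgebra
  have : Algebra.Etale (MvPolynomial (Fin n) F) Γ(X, V) := hτ
  obtain ⟨σ, _, _, g, θ', hsurj, hker, hJ⟩ :=
    exists_surjective_ker_eq_span_isUnit_jacobian (MvPolynomial (Fin n) F) Γ(X, V)
  let θ : MvPolynomial σ (MvPolynomial (Fin n) F) →+* Γ(X, V) := θ'
  have hθτ : ∀ p, θ (MvPolynomial.C p) = τ p := fun p => θ'.commutes p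
  have hθ : ∀ c : F, θ (MvPolynomial.C (MvPolynomial.C c)) = structHom π V c := fun c => by
    rw [hθτ, ← hτC]; rfl
  obtain ⟨Φ, hΦ₀, hΦ, hΦan⟩ := exists_openPartialHomeomorph_relMap g
    (relJacobian_coord_ne_zero θ hθ hJ x₀ hx₀)
  -- On `V(F)` the relations vanish, so `Φ` carries it into the slice `(t, 0)`; the chart is the
  -- projection to `t`.
  have hrel : ∀ x : RatPoint π, x.MemOpen V → Φ (coord π θ x) = ((coord π θ x).1, 0) := by
    intro x hx
    rw [hΦ]
    exact Prod.ext rfl (funext fun j => evalPair_coord_eq_zero θ hθ hker x hx j)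
  have hsymm : ∀ t : Fin n → F, (t, 0) ∈ Φ.target → relMap g (Φ.symm (t, 0)) = (t, 0) :=
    fun t ht => by rw [← hΦ, Φ.right_inv ht]
  have hex : ∀ t : Fin n → F, ∃ x : RatPoint π, (t, 0) ∈ Φ.target →
      x.MemOpen V ∧ coord π θ x = Φ.symm (t, 0) := by
    intro t
    by_cases ht : (t, 0) ∈ Φ.target
    · obtain ⟨x, hx⟩ := exists_coord_eq (π := π) θ hθ hV hsurj hker (Φ.symm (t, 0))
        fun j => congrFun (congrArg Prod.snd (hsymm t ht)) j
      exact ⟨x, fun _ => hx⟩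
    · exact ⟨x₀, fun h => absurd h ht⟩
  choose pt hpt using hex
  have hopen : IsOpen {t : Fin n → F | (t, (0 : σ → F)) ∈ Φ.target} :=
    Φ.open_target.preimage (by fun_prop)
  have han : ∀ t : Fin n → F, (t, 0) ∈ Φ.target →
      AnalyticAt F (fun t' : Fin n → F => Φ.symm (t', 0)) t := by
    intro t ht
    refine AnalyticAt.comp (g := Φ.symm) (f := fun t' : Fin n → F => (t', (0 : σ → F))) ?_
      (analyticAt_id.prod analyticAt_const)
    refine hΦan _ ht ?_
    rw [← (hpt t ht).2]
    exact relJacobian_coord_ne_zero θ hθ hJ _ (hpt t ht).1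
  -- Locally a regular function is a quotient of polynomials in the coordinates, evaluated along the
  -- analytic map `t ↦ Φ.symm (t, 0)`. Continuity of `pt` also follows, the topology being generated
  -- by such functions.
  have hreg : ∀ t : Fin n → F, (t, 0) ∈ Φ.target → ∀ (W : X.Opens) (f : Γ(X, W)),
      (pt t).MemOpen W → (∀ᶠ t' in 𝓝 t, (pt t').MemOpen W) ∧
        AnalyticAt F (fun t' => regVal π W f (pt t')) t := by
    intro t ht W f hW
    obtain ⟨a, b, hb, hab⟩ := (pt t).exists_regVal_eq_div hV (hpt t ht).1 hW f
    obtain ⟨a, rfl⟩ := hsurj a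
    obtain ⟨b, rfl⟩ := hsurj b
    have heval : ∀ t' (ht' : (t', 0) ∈ Φ.target) p,
        (pt t').evalHom V (hpt t' ht').1 (θ p) = evalPair (Φ.symm (t', 0)) p := by
      intro t' ht' p
      obtain ⟨hmem, hcoord⟩ := hpt t' ht'
      have h1 := congr($(evalPair_coord θ hθ _ hmem) p)
      rw [hcoord] at h1
      exact h1.symm
    have hanp : ∀ p, AnalyticAt F (fun t' : Fin n → F => evalPair (Φ.symm (t', 0)) p) t :=
      fun p => AnalyticAt.comp (g := fun z => evalPair z p) (analyticAt_evalPair p _) (han t ht)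
    have hbt : evalPair (Φ.symm (t, 0)) b ≠ 0 := by rw [← heval t ht]; exact hb
    have hev : ∀ᶠ t' in 𝓝 t, (pt t').MemOpen W ∧ regVal π W f (pt t') =
        evalPair (Φ.symm (t', 0)) a / evalPair (Φ.symm (t', 0)) b := by
      filter_upwards [hopen.mem_nhds ht, (hanp b).continuousAt.eventually_ne hbt] with t' ht' hb'
      have := hab (pt t') (hpt t' ht').1 (by
        change (pt t').evalHom V _ (θ b) ≠ 0
        rw [heval t' ht']; exact hb')
      rw [← heval t' ht', ← heval t' ht']
      exact this
    refine ⟨hev.mono fun _ h => h.1, ?_⟩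
    exact ((hanp a).div (hanp b) hbt).congr (hev.mono fun _ h => h.2.symm)
  have hcont : ∀ t : Fin n → F, (t, 0) ∈ Φ.target → ContinuousAt pt t := by
    intro t ht
    refine TopologicalSpace.tendsto_nhds_generateFrom_iff.2 ?_
    rintro _ ⟨W, f, O, hO, rfl⟩ ⟨hW, hfO⟩
    obtain ⟨h1, h2⟩ := hreg t ht W f hW
    exact h1.and (h2.continuousAt.eventually (hO.mem_nhds hfO))
  let ψ : OpenPartialHomeomorph (RatPoint π) (Fin n → F) :=
    { toFun := fun x => (coord π θ x).1
      invFun := pt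
      source := {x | x.MemOpen V} ∩ coord π θ ⁻¹' Φ.source
      target := {t | (t, 0) ∈ Φ.target}
      map_source' := fun x hx => by
        change ((coord π θ x).1, (0 : σ → F)) ∈ Φ.target
        rw [← hrel x hx.1]
        exact Φ.map_source hx.2
      map_target' := fun t ht => ⟨(hpt t ht).1, by
        rw [Set.mem_preimage, (hpt t ht).2]; exact Φ.map_target ht⟩
      left_inv' := fun x hx => by
        have ht : ((coord π θ x).1, (0 : σ → F)) ∈ Φ.target := by
          rw [← hrel x hx.1]; exact Φ.map_source hx.2
        refine eq_of_coord_eq θ hθ hV hsurj (hpt _ ht).1 hx.1 ?_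
        rw [(hpt _ ht).2, ← hrel x hx.1, Φ.left_inv hx.2]
      right_inv' := fun t ht => by
        rw [(hpt t ht).2]
        exact congrArg Prod.fst (hsymm t ht)
      open_source := (continuousOn_coord θ).isOpen_inter_preimage (isOpen_setOf_memOpen V)
        Φ.open_source
      open_target := hopen
      continuousOn_toFun := continuous_fst.comp_continuousOn
        ((continuousOn_coord θ).mono Set.inter_subset_left)
      continuousOn_invFun := fun t ht => (hcont t ht).continuousWithinAt }
  refine ⟨ψ, ⟨fun W f t ht hW => (hreg t ht W f hW).2, fun x hx => ?_⟩, ⟨hx₀, hΦ₀⟩,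
    fun x hx => hx.1, fun x i => ?_⟩
  · exact ⟨V, n, fun i => θ (MvPolynomial.C (MvPolynomial.X i)), id, hx.1, analyticAt_id,
      Filter.Eventually.of_forall fun _ => rfl⟩
  · rw [← hθτ]; rfl

end Chart

/-! ### Minimal primes and étale coordinates on a smooth variety. -/

/-- Regular functions that do not all vanish on any irreducible component do not all lie in a
minimal prime of the ring of an affine open set. -/
theorem exists_notMem_minimalPrime {X : Scheme.{u}} {r : ℕ} (φ : Fin r → Γ(X, ⊤))
    (hφ : ∀ Z ∈ irreducibleComponents X, ∃ i, ∃ z ∈ Z, z ∈ X.basicOpen (φ i))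
    {V : X.Opens} (hV : IsAffineOpen V) (Q : Ideal Γ(X, V)) (hQ : Q ∈ minimalPrimes Γ(X, V)) :
    ∃ i, X.presheaf.map (homOfLE (le_top : V ≤ ⊤)).op (φ i) ∉ Q := by
  have hQp : Q.IsPrime := hQ.1.1
  let q : Spec Γ(X, V) := (⟨Q, hQp⟩ : PrimeSpectrum Γ(X, V))
  have hxV : hV.fromSpec q ∈ V := hV.range_fromSpec.le ⟨q, rfl⟩
  obtain ⟨i, z, hz, hzi⟩ := hφ (irreducibleComponent (hV.fromSpec q))
    (irreducibleComponent_mem_irreducibleComponents _)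
  have hgen := (isIrreducible_irreducibleComponent (x := hV.fromSpec q)).isGenericPoint_genericPoint
    isClosed_irreducibleComponent
  set η := (isIrreducible_irreducibleComponent (x := hV.fromSpec q)).genericPoint
  -- The generic point of a component lies in every open set meeting it. Since `η` specializes to
  -- the point of `Q`, minimality of `Q` makes the two points equal.
  have hηi : η ∈ X.basicOpen (φ i) :=
    (hgen.mem_open_set_iff (X.basicOpen (φ i)).isOpen).2 ⟨z, hz, hzi⟩
  have hηV : η ∈ V :=
    (hgen.mem_open_set_iff V.isOpen).2 ⟨_, mem_irreducibleComponent, hxV⟩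
  have hsp : η ⤳ hV.fromSpec q := hgen.specializes mem_irreducibleComponent
  let p : Spec Γ(X, V) := hV.primeIdealOf ⟨η, hηV⟩
  have hp : hV.fromSpec p = η := hV.fromSpec_primeIdealOf ⟨η, hηV⟩
  rw [← hp, hV.fromSpec.isOpenEmbedding.isInducing.specializes_iff] at hsp
  have hle : (hV.primeIdealOf ⟨η, hηV⟩).asIdeal ≤ Q :=
    (PrimeSpectrum.le_iff_specializes (hV.primeIdealOf ⟨η, hηV⟩)
      (⟨Q, hQp⟩ : PrimeSpectrum Γ(X, V))).2 hsp
  have hpq : (hV.primeIdealOf ⟨η, hηV⟩ : PrimeSpectrum Γ(X, V)) = ⟨Q, hQp⟩ :=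
    PrimeSpectrum.ext (le_antisymm hle
      (hQ.2 ⟨(hV.primeIdealOf ⟨η, hηV⟩).isPrime, bot_le⟩ hle))
  have hqη : hV.fromSpec q = η := by
    rw [← hp]; exact congrArg hV.fromSpec hpq.symm
  refine ⟨i, ?_⟩
  have hmem : q ∈ hV.fromSpec ⁻¹ᵁ
      X.basicOpen (X.presheaf.map (homOfLE (le_top : V ≤ ⊤)).op (φ i)) := by
    rw [Scheme.basicOpen_res]
    change hV.fromSpec q ∈ V ⊓ X.basicOpen (φ i)
    exact ⟨hxV, hqη ▸ hηi⟩
  rw [hV.fromSpec_preimage_basicOpen] at hmem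
  exact hmem

/-- A smooth variety is covered by affine open sets with étale coordinates. -/
theorem exists_etale_coordinates {F : Type u} [Field F] {X : Scheme.{u}}
    (π : X ⟶ Spec (CommRingCat.of F)) [Smooth π] (x : X) :
    ∃ (V : X.Opens) (n : ℕ) (τ : MvPolynomial (Fin n) F →+* Γ(X, V)), IsAffineOpen V ∧ x ∈ V ∧
      τ.Etale ∧ τ.comp MvPolynomial.C = structHom π V := by
  obtain ⟨U, hU, V, hV, hxV, e, hstd⟩ := Smooth.exists_isStandardSmooth π x
  have hUtop : U = ⊤ := by
    refine top_unique fun y _ => ?_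
    have : y = π x := Subsingleton.elim (α := PrimeSpectrum F) _ _
    rw [this]; exact e hxV
  subst hUtop
  have h2 : (structHom π V).IsStandardSmooth :=
    RingHom.isStandardSmooth_respectsIso.2 _
      (Scheme.ΓSpecIso (CommRingCat.of F)).symm.commRingCatIsoToRingEquiv hstd
  obtain ⟨n, τ, hτC, hτ⟩ := h2.exists_etale_mvPolynomial
  exact ⟨V, n, τ, hV, hxV, hτ, hτC⟩

theorem regVal_eq_eval {F : Type u} [Field F] {X : Scheme.{u}}
    {π : X ⟶ Spec (CommRingCat.of F)} {V : X.Opens} {n : ℕ}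
    (τ : MvPolynomial (Fin n) F →+* Γ(X, V))
    (hτC : τ.comp MvPolynomial.C = structHom π V) (x : RatPoint π) (hx : x.MemOpen V)
    (p : MvPolynomial (Fin n) F) :
    regVal π V (τ p) x =
      MvPolynomial.eval (fun i => regVal π V (τ (MvPolynomial.X i)) x) p := by
  rw [regVal_eq_evalHom x V hx]
  have : (x.evalHom V hx).comp τ =
      MvPolynomial.eval (fun i => regVal π V (τ (MvPolynomial.X i)) x) := by
    refine MvPolynomial.ringHom_ext' ?_ fun i => ?_
    · rw [RingHom.comp_assoc, hτC, x.evalHom_comp_structHom]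
      ext c; simp
    · simp [regVal_eq_evalHom x V hx]
  rw [← this]; rfl

/-- By the ultrametric inequality some `‖φ i‖` is at least `‖∑ c i * φ i‖ / C`. If the sum vanishes,
the right side is `∞` because `C > 0`. -/
theorem iInf_enorm_rpow_neg_le {F : Type*} [NormedField F] [IsUltrametricDist F]
    {r : ℕ} (c φ : Fin r → F) {C : ℝ≥0} (hC : 0 < C)
    (hcC : ∀ i, ‖c i‖ ≤ C) {s : ℝ} (hs : 0 < s) :
    ⨅ i, ‖φ i‖ₑ ^ (-s) ≤ (C : ℝ≥0∞) ^ s * ‖∑ i, c i * φ i‖ₑ ^ (-s) := by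
  by_cases h0 : ∑ i, c i * φ i = 0
  · have : (C : ℝ≥0∞) ^ s ≠ 0 := by simp [hC.ne']
    simp [h0, hs, this]
  have hne : (Finset.univ : Finset (Fin r)).Nonempty := by
    by_contra hcon
    rw [Finset.not_nonempty_iff_eq_empty] at hcon
    exact h0 (by rw [hcon, Finset.sum_empty])
  obtain ⟨i, -, hi⟩ := IsUltrametricDist.exists_norm_finsetSum_le_of_nonempty hne
    (fun i => c i * φ i)
  rw [norm_mul] at hi
  have hi2 : ‖∑ i, c i * φ i‖ ≤ C * ‖φ i‖ :=
    hi.trans (mul_le_mul_of_nonneg_right (hcC i) (norm_nonneg _))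
  have hφ0 : φ i ≠ 0 := by
    intro h; rw [h, norm_zero, mul_zero] at hi2
    exact h0 (norm_le_zero_iff.1 hi2)
  have hi3 : ‖∑ i, c i * φ i‖ₑ ≤ C * ‖φ i‖ₑ := by
    rw [enorm_eq_nnnorm, enorm_eq_nnnorm, ← ENNReal.coe_mul, ENNReal.coe_le_coe]
    exact hi2
  have hCe : (C : ℝ≥0∞) ≠ 0 := by simpa using hC.ne'
  calc ⨅ i, ‖φ i‖ₑ ^ (-s) ≤ ‖φ i‖ₑ ^ (-s) := iInf_le _ i
    _ = (C : ℝ≥0∞) ^ s * (C * ‖φ i‖ₑ) ^ (-s) := by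
        rw [ENNReal.mul_rpow_of_ne_zero hCe (by simpa using hφ0), ← mul_assoc,
          ← ENNReal.rpow_add _ _ hCe ENNReal.coe_ne_top, add_neg_cancel, ENNReal.rpow_zero, one_mul]
    _ ≤ _ := by
        refine mul_le_mul_right ?_ _
        rw [ENNReal.rpow_neg, ENNReal.rpow_neg, ENNReal.inv_le_inv]
        exact ENNReal.rpow_le_rpow hi3 hs.le

/-! ### Integrability against smooth measures, and the uniform bound. -/

section LocalIntegrability

variable {F : Type u} [NontriviallyNormedField F] [IsUltrametricDist F] [LocallyCompactSpace F]
  [MeasurableSpace F] [BorelSpace F]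

/-- A function dominated in a chart by an integrable function is integrable for every smooth
measure with compact support in the domain of the chart. -/
theorem lintegral_lt_top_of_isSmoothMeasure {M : Type v} [TopologicalSpace M] [MeasurableSpace M]
    [BorelSpace M] {A : ∀ n : ℕ, Set (OpenPartialHomeomorph M (Fin n → F))} {n : ℕ}
    {ψ : OpenPartialHomeomorph M (Fin n → F)} (hψ : ψ ∈ A n) {μ : Measure M}
    (hμ : IsSmoothMeasure A μ) {K : Set M} (hK : IsCompact K) (hKψ : K ⊆ ψ.source)
    (hμK : μ Kᶜ = 0) {f : M → ℝ≥0∞} {h : (Fin n → F) → ℝ≥0∞} (hh : Measurable h)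
    (hfh : ∀ x ∈ K, f x ≤ h (ψ x)) (hint : ∫⁻ y in ψ '' K, h y ∂(haar F n) < ∞) :
    ∫⁻ x, f x ∂μ < ∞ := by
  have : ProperSpace F := ProperSpace.of_locallyCompactSpace F
  obtain ⟨ρ, hρ, hmap⟩ := hμ n ψ hψ
  have hL : IsCompact (ψ '' K) := hK.image_of_continuousOn (ψ.continuousOn.mono hKψ)
  have hLt : ψ '' K ⊆ ψ.target := by
    rintro _ ⟨x, hx, rfl⟩; exact ψ.map_source (hKψ hx)
  have hLm : MeasurableSet (ψ '' K) := hL.isClosed.measurableSet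
  have hρc : ContinuousOn ρ ψ.target := fun y hy =>
    (tendsto_const_nhds.congr' ((hρ y hy).mono fun _ h => h.symm)).mono_left nhdsWithin_le_nhds
  -- A locally constant density is continuous, hence bounded on the compact image of the support.
  obtain ⟨C, hC⟩ : ∃ C, ∀ y ∈ ψ '' K, ρ y ≤ C := by
    obtain ⟨C, hC⟩ := (hL.image_of_continuousOn (hρc.mono hLt)).bddAbove
    exact ⟨C, fun y hy => hC ⟨y, hy, rfl⟩⟩
  have hsm : MeasurableSet ψ.source := ψ.open_source.measurableSet
  have hψm : AEMeasurable ψ (μ.restrict ψ.source) := ψ.continuousOn.aemeasurable hsm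
  have hρm : AEMeasurable (fun y => (ρ y : ℝ≥0∞)) ((haar F n).restrict ψ.target) :=
    (hρc.aemeasurable ψ.open_target.measurableSet).coe_nnreal_ennreal
  have hhm : Measurable ((ψ '' K).indicator h) := hh.indicator hLm
  calc ∫⁻ x, f x ∂μ ≤ ∫⁻ x, ψ.source.indicator (fun x => (ψ '' K).indicator h (ψ x)) x ∂μ := by
        refine lintegral_mono_ae ?_
        filter_upwards [show ∀ᵐ x ∂μ, x ∈ K from hμK] with x hx
        rw [Set.indicator_of_mem (hKψ hx), Set.indicator_of_mem (Set.mem_image_of_mem ψ hx)]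
        exact hfh x hx
    _ = ∫⁻ y, (ψ '' K).indicator h y ∂((μ.restrict ψ.source).map ψ) := by
        rw [lintegral_indicator hsm, lintegral_map' hhm.aemeasurable hψm]
    _ = ∫⁻ y in ψ.target, (ρ y : ℝ≥0∞) * (ψ '' K).indicator h y ∂(haar F n) := by
        rw [hmap, lintegral_withDensity_eq_lintegral_mul₀ hρm hhm.aemeasurable]
        rfl
    _ ≤ ∫⁻ y, (ψ '' K).indicator (fun y => (C : ℝ≥0∞) * h y) y ∂(haar F n) := by
        refine (setLIntegral_le_lintegral _ _).trans (lintegral_mono fun y => ?_)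
        by_cases hy : y ∈ ψ '' K
        · rw [Set.indicator_of_mem hy, Set.indicator_of_mem hy]
          gcongr
          exact hC y hy
        · rw [Set.indicator_of_notMem hy, Set.indicator_of_notMem hy, mul_zero]
    _ = C * ∫⁻ y in ψ '' K, h y ∂(haar F n) := by
        rw [lintegral_indicator hLm, lintegral_const_mul _ hh]
    _ < ∞ := ENNReal.mul_lt_top ENNReal.coe_lt_top hint

variable {X : Scheme.{u}} {π : X ⟶ Spec (CommRingCat.of F)} {V : X.Opens} {n : ℕ}

/-- On an affine open set with étale coordinates, the threshold is bounded below uniformly. -/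
theorem exists_integrableNear_of_etale {r : ℕ} (φ : Fin r → Γ(X, ⊤))
    (hφ : ∀ Z ∈ irreducibleComponents X, ∃ i, ∃ z ∈ Z, z ∈ X.basicOpen (φ i))
    (hV : IsAffineOpen V) (τ : MvPolynomial (Fin n) F →+* Γ(X, V)) (hτ : τ.Etale)
    (hτC : τ.comp MvPolynomial.C = structHom π V) :
    ∃ s : ℝ≥0, 0 < s ∧ ∀ x₀ : RatPoint π, x₀.MemOpen V →
      IntegrableNear (analyticCharts π) (fun i => regVal π ⊤ (φ i)) x₀ s := by
  have : ProperSpace F := ProperSpace.of_locallyCompactSpace F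
  let φV : Fin r → Γ(X, V) := fun i => X.presheaf.map (homOfLE (le_top : V ≤ ⊤)).op (φ i)
  obtain ⟨a, ha0, ha⟩ : ∃ a : MvPolynomial (Fin n) F, a ≠ 0 ∧ τ a ∈ Ideal.span (Set.range φV) := by
    let := τ.toAlgebra
    have : Algebra.Etale (MvPolynomial (Fin n) F) Γ(X, V) := hτ
    refine exists_ne_zero_algebraMap_mem (Ideal.span (Set.range φV)) fun Q hQ hle => ?_
    obtain ⟨i, hi⟩ := exists_notMem_minimalPrime φ hφ hV Q hQ
    exact hi (hle (Ideal.subset_span ⟨i, rfl⟩))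
  obtain ⟨c, hc⟩ := Ideal.mem_span_range_iff_exists_fun.1 ha
  -- The exponent is fixed before `x₀`, the chart and the measure; only the finite value of the
  -- integral depends on these.
  obtain ⟨s, hs, hint⟩ := exists_setLIntegral_haar_rpow_neg_lt_top a ha0
  refine ⟨s, hs, fun x₀ hx₀ => ?_⟩
  obtain ⟨ψ, hψ, hx₀ψ, hψV, hψτ⟩ := exists_analyticChart_of_etale hV τ hτ hτC x₀ hx₀
  refine ⟨ψ.source, ψ.open_source, hx₀ψ, fun μ hμ ⟨K, hK, hKψ, hμK⟩ => ?_⟩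
  obtain ⟨C, hC⟩ := hK.exists_bound_of_continuousOn (f := fun x i => regVal π V (c i) x)
    (continuousOn_pi.2 fun i => (continuousOn_regVal V (c i)).mono fun x hx => hψV x (hKψ hx))
  let C' : ℝ≥0 := C.toNNReal + 1
  have hC' : 0 < C' := by positivity
  refine lintegral_lt_top_of_isSmoothMeasure hψ hμ hK hKψ hμK
    (h := fun y => (C' : ℝ≥0∞) ^ (s : ℝ) * ‖MvPolynomial.eval y a‖ₑ ^ (-(s : ℝ)))
    ((measurable_enorm_eval_rpow a _).const_mul _) (fun x hx => ?_) ?_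
  · have hxV := hψV x (hKψ hx)
    have heval : MvPolynomial.eval (ψ x) a =
        ∑ i, regVal π V (c i) x * regVal π ⊤ (φ i) x := by
      have h1 : ψ x = fun i => regVal π V (τ (MvPolynomial.X i)) x := funext (hψτ x)
      rw [h1, ← regVal_eq_eval τ hτC x hxV, ← hc, regVal_eq_evalHom x V hxV, map_sum]
      refine Finset.sum_congr rfl fun i _ => ?_
      rw [map_mul, regVal_eq_evalHom x V hxV, regVal_eq_evalHom x ⊤ x.memOpen_top,
        x.evalHom_map]
    rw [heval]
    refine iInf_enorm_rpow_neg_le _ _ hC' (fun i => ?_) hs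
    calc ‖regVal π V (c i) x‖ ≤ C := (norm_le_pi_norm _ i).trans (hC x hx)
      _ ≤ C' := by
        rw [NNReal.coe_add]
        have := Real.le_coe_toNNReal C
        have h1 : (0 : ℝ) ≤ ((1 : ℝ≥0) : ℝ) := NNReal.coe_nonneg _
        linarith
  · rw [lintegral_const_mul _ (measurable_enorm_eval_rpow a _)]
    refine ENNReal.mul_lt_top (ENNReal.rpow_lt_top_of_nonneg s.2 ENNReal.coe_ne_top)
      (hint _ (hK.image_of_continuousOn (ψ.continuousOn.mono hKψ)))

end LocalIntegrability

end AnalyticLct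

end

/-- `F` is a non-Archimedean local field with an absolute value, `π : X ⟶ Spec F` a smooth
`F`-variety, and `φ` a finite family of regular functions on `X` which do not simultaneously
vanish identically on any irreducible component of `X`. -/
theorem theorem2 {F : Type u} [NontriviallyNormedField F] [IsUltrametricDist F]
    [LocallyCompactSpace F] [MeasurableSpace F] [BorelSpace F]
    {X : Scheme.{u}} (π : X ⟶ Spec (CommRingCat.of F))
    [Smooth π] [IsSeparated π] [QuasiCompact π]
    {r : ℕ} (φ : Fin r → Γ(X, ⊤))
    (hφ : ∀ Z ∈ irreducibleComponents X, ∃ i, ∃ z ∈ Z, z ∈ X.basicOpen (φ i)) :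
    ∃ ε : ℝ≥0, 0 < ε ∧ ∀ x₀ : AnalyticLct.RatPoint π,
      (ε : ℝ≥0∞) < AnalyticLct.lct (AnalyticLct.analyticCharts π)
        (fun i => AnalyticLct.regVal π ⊤ (φ i)) x₀ := by
  have hloc : ∀ x : X, ∃ (V : X.Opens) (s : ℝ≥0), x ∈ V ∧ 0 < s ∧
      ∀ x₀ : AnalyticLct.RatPoint π, x₀.MemOpen V →
        AnalyticLct.IntegrableNear (AnalyticLct.analyticCharts π)
          (fun i => AnalyticLct.regVal π ⊤ (φ i)) x₀ s := by
    intro x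
    obtain ⟨V, n, τ, hV, hxV, hτ, hτC⟩ := AnalyticLct.exists_etale_coordinates π x
    obtain ⟨s, hs, h⟩ := AnalyticLct.exists_integrableNear_of_etale φ hφ hV τ hτ hτC
    exact ⟨V, s, hxV, hs, h⟩
  choose V s hxV hs hint using hloc
  have : CompactSpace X := QuasiCompact.compactSpace_of_compactSpace π
  obtain ⟨t, ht⟩ := isCompact_univ.elim_finite_subcover (fun x : X => (V x : Set X))
    (fun x => (V x).isOpen) (fun x _ => Set.mem_iUnion.2 ⟨x, hxV x⟩)
  -- Taken from a neighbourhood filter, so an empty cover needs no separate case.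
  obtain ⟨ε, hεt, hε⟩ : ∃ ε : ℝ≥0, (∀ x ∈ t, ε < s x) ∧ 0 < ε := by
    have h1 : ∀ᶠ ε in 𝓝[>] (0 : ℝ≥0), ∀ x ∈ t, ε < s x :=
      (Filter.eventually_all_finset t).2 fun x _ =>
        nhdsWithin_le_nhds (eventually_lt_nhds (hs x))
    exact (h1.and self_mem_nhdsWithin).exists
  refine ⟨ε, hε, fun x₀ => ?_⟩
  let z : Spec (CommRingCat.of F) := (⊥ : PrimeSpectrum F)
  obtain ⟨x, hxt, hx⟩ := Set.mem_iUnion₂.1 (ht (Set.mem_univ (x₀.1 z)))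
  calc (ε : ℝ≥0∞) < s x := ENNReal.coe_lt_coe.2 (hεt x hxt)
    _ ≤ _ := by
      rw [AnalyticLct.lct]
      exact le_sSup ⟨s x, hint x x₀ ((x₀.memOpen_iff _ z).2 hx), rfl⟩
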